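/- Theorem 4.1. All graphs are finite and are drawn in the plane so that vertices are distinct points; every edge is a simple arc joining its two endpoints and passing through no other vertex; apart from common endpoints, two edges meet only in proper crossings, at points interior to both; no three edges cross at a point; and edges with a common endpoint do not cross. A graph is *1-planar* if it has such a drawing in which every edge is crossed at most once. It is *IC-planar* if it has a 1-planar drawing in which, moreover, no two crossings have a common endpoint, where the endpoints of a crossing are the endpoints of the two edges that cross. The *cycle space* $\mathcal C(G)$ is the vector space over $\mathbb F_2$ of all edge sets of $G$ for which every vertex is incident with an even number of edges of the set, with symmetric difference as addition. The *basis number* $b(G)$ is the smallest $k$ such that $\mathcal C(G)$ has a basis $\mathcal B$ for which every edge of $G$ belongs to at most $k$ members of $\mathcal B$. For every integer $\ell$ there exists a (simple) 1-planar graph $G$ with $b(G)\ge \ell$ and maximum degree $\Delta(G)=3$. In fact, $G$ can be taken to be IC-planar. -/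

import Mathlib

namespace SimpleGraph

section CycleSpace

variable {V : Type*} [Fintype V] (G : SimpleGraph V)

open Classical in
/-- The cycle space of a finite graph, as a vector space over the field with two elements.
A vector `x : G.edgeSet → ZMod 2` encodes the set of edges `e` with `x e ≠ 0`, so that addition
is the symmetric difference. The members are the Eulerian edge sets, i.e. those for which every
vertex lies on an even number of edges of the set (see `mem_cycleSpace_iff_even`). -/
noncomputable def cycleSpace : Submodule (ZMod 2) (G.edgeSet → ZMod 2) where
  carrier := {x | ∀ v : V, ∑ e : G.edgeSet with v ∈ e.val, x e = 0}
  add_mem' := by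
    intro x y hx hy v
    have h1 := hx v
    have h2 := hy v
    simp [Finset.sum_add_distrib, h1, h2]
  zero_mem' := by
    intro v
    simp
  smul_mem' := by
    intro c x hx v
    have h1 := hx v
    simp [← Finset.mul_sum, h1]

/-- The members of the cycle space are the edge sets in which all vertex degrees are even. -/
theorem mem_cycleSpace_iff_even (x : G.edgeSet → ZMod 2) :
    x ∈ G.cycleSpace ↔ ∀ v : V, Even {e : G.edgeSet | v ∈ (e : Sym2 V) ∧ x e ≠ 0}.ncard := by
  classical
  have key : ∀ a : ZMod 2, a = if a ≠ 0 then 1 else 0 := by decide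
  change (∀ v : V, _ = _) ↔ _
  refine forall_congr' fun v => ?_
  have h1 : {e : G.edgeSet | v ∈ (e : Sym2 V) ∧ x e ≠ 0} =
      ((Finset.univ.filter fun e : G.edgeSet => v ∈ (e : Sym2 V)).filter
        fun e => x e ≠ 0 : Finset G.edgeSet) := by
    ext e
    simp
  rw [h1, Set.ncard_coe_finset, ← ZMod.natCast_eq_zero_iff_even,
    Finset.sum_congr rfl fun e _ => key (x e), Finset.sum_boole]

/-- `B` is a `k`-basis of `G`: a basis of the cycle space of `G` such that every edge belongs to
at most `k` members of `B`. -/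
def IsCycleBasis (k : ℕ) (B : Set (G.edgeSet → ZMod 2)) : Prop :=
  Submodule.span (ZMod 2) B = G.cycleSpace ∧
  LinearIndepOn (ZMod 2) id B ∧
  ∀ e : G.edgeSet, {x ∈ B | x e ≠ 0}.encard ≤ k

/-- The basis number of `G`: the least `k` such that `G` has a `k`-basis. -/
noncomputable def basisNumber : ℕ :=
  sInf {k : ℕ | ∃ B, G.IsCycleBasis k B}

/-- The infimum defining the basis number is over a nonempty set, hence it is attained. -/
theorem exists_isCycleBasis_basisNumber : ∃ B, G.IsCycleBasis G.basisNumber B := by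
  classical
  have hne : {k : ℕ | ∃ B, G.IsCycleBasis k B}.Nonempty := by
    obtain ⟨B, -, hspan, hli⟩ :=
      exists_linearIndependent (ZMod 2) (G.cycleSpace : Set (G.edgeSet → ZMod 2))
    refine ⟨B.ncard, B, by rw [hspan, Submodule.span_eq], hli, fun e => ?_⟩
    rw [B.toFinite.cast_ncard_eq]
    exact Set.encard_le_encard (Set.sep_subset _ _)
  exact Nat.sInf_mem hne

end CycleSpace

section Drawing

/-- The relative interior of a parametrized arc in the plane: the arc without its two ends. -/
def arcInterior (γ : C(unitInterval, ℝ × ℝ)) : Set (ℝ × ℝ) :=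
  γ '' Set.Ioo 0 1

/-- The plane sets `A` and `B` cross properly at the point `p`: in suitable local coordinates
around `p`, the set `A` is the horizontal and `B` the vertical coordinate axis, with `p` at the
origin. In particular, they do not merely touch. -/
def CrossProperlyAt (A B : Set (ℝ × ℝ)) (p : ℝ × ℝ) : Prop :=
  ∃ φ : OpenPartialHomeomorph (ℝ × ℝ) (ℝ × ℝ), p ∈ φ.source ∧ φ p = 0 ∧
    ∀ q ∈ φ.source, (q ∈ A ↔ (φ q).2 = 0) ∧ (q ∈ B ↔ (φ q).1 = 0)

variable {V : Type*}

/-- A drawing of `G` in the plane, possibly with crossings. Vertices are distinct points and edges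
are simple arcs joining their endpoints and passing through no other vertex. Any two edges
intersect, apart from common endpoints, only in proper crossings; no three edges cross at
a point, and edges with a common endpoint do not cross. -/
structure PlaneDrawing (G : SimpleGraph V) where
  /-- the point that represents a vertex -/
  pos : V → ℝ × ℝ
  pos_injective : Function.Injective pos
  /-- the arc that represents an edge -/
  arc : G.edgeSet → C(unitInterval, ℝ × ℝ)
  arc_injective : ∀ e, Function.Injective (arc e)
  arc_ends : ∀ e, s(arc e 0, arc e 1) = (e : Sym2 V).map pos
  pos_notMem_arcInterior : ∀ v e, pos v ∉ arcInterior (arc e)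
  cross_properly : ∀ (e f : G.edgeSet) p, e ≠ f → p ∈ arcInterior (arc e) → p ∈ arcInterior (arc f) →
    CrossProperlyAt (arcInterior (arc e)) (arcInterior (arc f)) p
  no_three_cross : ∀ (e f g : G.edgeSet) p, e ≠ f → e ≠ g → f ≠ g →
    ¬ (p ∈ arcInterior (arc e) ∧ p ∈ arcInterior (arc f) ∧ p ∈ arcInterior (arc g))
  adjacent_not_cross : ∀ (e f : G.edgeSet) (v : V), e ≠ f →
    v ∈ (e : Sym2 V) → v ∈ (f : Sym2 V) →
    Disjoint (arcInterior (arc e)) (arcInterior (arc f))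

namespace PlaneDrawing

variable {G : SimpleGraph V} (D : G.PlaneDrawing)

/-- The two different edges `e` and `f` cross at the point `p` of the drawing. -/
def IsCrossing (p : ℝ × ℝ) (e f : G.edgeSet) : Prop :=
  e ≠ f ∧ p ∈ arcInterior (D.arc e) ∧ p ∈ arcInterior (D.arc f)

/-- The drawing is 1-planar: on each edge there is at most one crossing. -/
def IsOnePlane : Prop :=
  ∀ e f g p q, D.IsCrossing p e f → D.IsCrossing q e g → p = q

/-- `v` is an endpoint of the crossing at `p`, i.e. an endpoint of an edge that is crossed
there. -/
def IsCrossingEndpoint (p : ℝ × ℝ) (v : V) : Prop :=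
  ∃ e f : G.edgeSet, D.IsCrossing p e f ∧ v ∈ (e : Sym2 V)

/-- No two crossings of the drawing have a common endpoint. -/
def HasIndependentCrossings : Prop :=
  ∀ p q v, D.IsCrossingEndpoint p v → D.IsCrossingEndpoint q v → p = q

end PlaneDrawing

/-- `G` is 1-planar: it has a 1-planar drawing. -/
def IsOnePlanar (G : SimpleGraph V) : Prop :=
  ∃ D : G.PlaneDrawing, D.IsOnePlane

/-- `G` is IC-planar (independent crossing 1-planar): it has a 1-planar drawing in which no two
crossings have a common endpoint. -/
def IsICPlanar (G : SimpleGraph V) : Prop :=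
  ∃ D : G.PlaneDrawing, D.IsOnePlane ∧ D.HasIndependentCrossings

end Drawing

end SimpleGraph

/-! Large girth forces large basis number, and replacing vertices by paths and subdividing edges
preserves enough of this to allow a drawing with independent crossings and maximum degree 3.

Let H be a cubic bipartite multigraph with 2q vertices and 3q edges in which every nonempty even
edge set has at least r edges. Draw each vertex of H as a row and each edge as a column. Where an
edge meets one of its ends, row and column share a node of degree 3; elsewhere they cross, and each
crossing lies in a tile of its own with four private endpoints. The resulting `gridGraph` is
therefore IC-planar (`gridGraph_isICPlanar`).

Contracting the rows gives back H up to subdivision and acyclic pieces. So a member of the cycle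
space is determined by its values on one representative edge `repEdge` per column
(`eq_zero_of_comp_repEdge`), these values form an even set of H (`isEven_comp_repEdge`), and every
even set arises (`gridLift_mem_cycleSpace`). The dimension is thus at least 3q - 2q = q, and each
basis member contains at least r representative edges. Counting pairs of a basis member and a
representative edge in it gives q * r ≤ b * 3q for the basis number b
(`mul_le_basisNumber_gridGraph_mul`); r = 3k yields b ≥ k.

H is the bipartite double cover of a Cayley graph generated by three involutions acting on a
truncated 3-regular tree of reduced words. A reduced product of at most r involutions moves the
root, so short closed walks must backtrack (`walk_ne`, `le_card_support_of_even`). -/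

namespace SimpleGraph

/-! ### Orthogonal drawings from lattice layouts -/

section OrthogonalDrawing

/-- The open horizontal segment between two points at the same height. -/
def horizontalSegment (x₁ x₂ y : ℝ) : Set (ℝ × ℝ) :=
  {q | q.2 = y ∧ x₁ < q.1 ∧ q.1 < x₂}

/-- The open vertical segment between two points with the same abscissa. -/
def verticalSegment (x y₁ y₂ : ℝ) : Set (ℝ × ℝ) :=
  {q | q.1 = x ∧ y₁ < q.2 ∧ q.2 < y₂}

theorem CrossProperlyAt.symm {A B : Set (ℝ × ℝ)} {p : ℝ × ℝ} (h : CrossProperlyAt A B p) :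
    CrossProperlyAt B A p := by
  obtain ⟨φ, hp, h0, hφ⟩ := h
  refine ⟨φ.transHomeomorph (Homeomorph.prodComm ℝ ℝ), by simpa using hp, by simp [h0], ?_⟩
  intro q hq
  have := hφ q (by simpa using hq)
  simpa using this.symm

theorem crossProperlyAt_segments {x₁ x₂ y x y₁ y₂ : ℝ} (hx₁ : x₁ < x) (hx₂ : x < x₂)
    (hy₁ : y₁ < y) (hy₂ : y < y₂) :
    CrossProperlyAt (horizontalSegment x₁ x₂ y) (verticalSegment x y₁ y₂) (x, y) := by
  -- The chart is a translation, restricted to an open rectangle in which the segments coincide with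
  -- full lines.
  refine ⟨(Homeomorph.addRight (-(x, y))).toOpenPartialHomeomorph.restrOpen
    (Set.Ioo x₁ x₂ ×ˢ Set.Ioo y₁ y₂) (isOpen_Ioo.prod isOpen_Ioo), ?_, ?_, ?_⟩
  · simp [*]
  · simp
  · rintro ⟨a, b⟩ hq
    simp only [OpenPartialHomeomorph.restrOpen_source, Homeomorph.toOpenPartialHomeomorph_source,
      Set.univ_inter, Set.mem_prod, Set.mem_Ioo] at hq
    simp [horizontalSegment, verticalSegment, hq, ← sub_eq_add_neg, sub_eq_zero]

theorem openSegment_horizontal {x₁ x₂ : ℝ} (y : ℝ) (h : x₁ < x₂) :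
    openSegment ℝ (x₁, y) (x₂, y) = horizontalSegment x₁ x₂ y := by
  rw [← Prod.image_mk_openSegment_left, openSegment_eq_Ioo h]
  ext ⟨a, b⟩
  simp [horizontalSegment, eq_comm, and_comm]

theorem openSegment_vertical {y₁ y₂ : ℝ} (x : ℝ) (h : y₁ < y₂) :
    openSegment ℝ (x, y₁) (x, y₂) = verticalSegment x y₁ y₂ := by
  rw [← Prod.image_mk_openSegment_right, openSegment_eq_Ioo h]
  ext ⟨a, b⟩
  simp [verticalSegment, eq_comm, and_comm]

/-- The straight arc between two points. -/
noncomputable def straightArc (a b : ℝ × ℝ) : C(unitInterval, ℝ × ℝ) where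
  toFun t := AffineMap.lineMap a b (t : ℝ)
  continuous_toFun := by
    have := AffineMap.lineMap_continuous (R := ℝ) (p := a) (q := b)
    fun_prop

theorem arcInterior_straightArc (a b : ℝ × ℝ) :
    arcInterior (straightArc a b) = openSegment ℝ a b := by
  rw [openSegment_eq_image_lineMap]
  ext q
  constructor
  · rintro ⟨t, ht, rfl⟩
    exact ⟨t, ⟨ht.1, ht.2⟩, rfl⟩
  · rintro ⟨t, ht, rfl⟩
    exact ⟨⟨t, ht.1.le, ht.2.le⟩, ⟨ht.1, ht.2⟩, rfl⟩

theorem straightArc_injective {a b : ℝ × ℝ} (h : a ≠ b) :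
    Function.Injective (straightArc a b) :=
  fun _ _ hst => Subtype.ext (AffineMap.lineMap_injective ℝ h hst)

/-- A lattice point as a point of the plane. -/
def latticePoint (p : ℤ × ℤ) : ℝ × ℝ := (p.1, p.2)

theorem latticePoint_injective : Function.Injective latticePoint := by
  rintro ⟨a, b⟩ ⟨c, d⟩ h
  simpa [latticePoint] using h

variable {V : Type*} {G : SimpleGraph V}

/-- An orthogonal grid layout of a graph: vertices are distinct lattice points, edges are
horizontal or vertical segments, and no vertex lies in the interior of an edge. -/
structure GridLayout (G : SimpleGraph V) where
  /-- the lattice point that represents a vertex -/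
  pos : V → ℤ × ℤ
  pos_injective : Function.Injective pos
  axis_parallel : ∀ a b, G.Adj a b → (pos a).2 = (pos b).2 ∨ (pos a).1 = (pos b).1
  not_between_horizontal : ∀ a b c, G.Adj a b → (pos a).2 = (pos b).2 → (pos c).2 = (pos a).2 →
    ¬ ((pos a).1 < (pos c).1 ∧ (pos c).1 < (pos b).1)
  not_between_vertical : ∀ a b c, G.Adj a b → (pos a).1 = (pos b).1 → (pos c).1 = (pos a).1 →
    ¬ ((pos a).2 < (pos c).2 ∧ (pos c).2 < (pos b).2)

namespace GridLayout

variable (P : G.GridLayout)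

/-- The edge `e` is drawn as the horizontal segment from `a` to `b`. -/
def IsHorizontal (e : G.edgeSet) (a b : V) : Prop :=
  G.Adj a b ∧ (e : Sym2 V) = s(a, b) ∧ (P.pos a).2 = (P.pos b).2 ∧ (P.pos a).1 < (P.pos b).1

/-- The edge `e` is drawn as the vertical segment from `a` to `b`. -/
def IsVertical (e : G.edgeSet) (a b : V) : Prop :=
  G.Adj a b ∧ (e : Sym2 V) = s(a, b) ∧ (P.pos a).1 = (P.pos b).1 ∧ (P.pos a).2 < (P.pos b).2

/-- The arc that represents an edge. -/
noncomputable def edgeArc (e : G.edgeSet) : C(unitInterval, ℝ × ℝ) :=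
  straightArc (latticePoint (P.pos (Quot.out e.val).1)) (latticePoint (P.pos (Quot.out e.val).2))

theorem arcInterior_edgeArc {e : G.edgeSet} {a b : V} (h : (e : Sym2 V) = s(a, b)) :
    arcInterior (P.edgeArc e) =
      openSegment ℝ (latticePoint (P.pos a)) (latticePoint (P.pos b)) := by
  rw [edgeArc, arcInterior_straightArc]
  have h2 : s((Quot.out e.val).1, (Quot.out e.val).2) = s(a, b) := by
    rw [← h]
    exact Quot.out_eq e.val
  rcases Sym2.eq_iff.1 h2 with ⟨h1, h2⟩ | ⟨h1, h2⟩
  · rw [h1, h2]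
  · rw [h1, h2, openSegment_symm]

theorem arcInterior_of_isHorizontal {e : G.edgeSet} {a b : V} (h : P.IsHorizontal e a b) :
    arcInterior (P.edgeArc e) =
      horizontalSegment (P.pos a).1 (P.pos b).1 (P.pos a).2 := by
  rw [P.arcInterior_edgeArc h.2.1, ← openSegment_horizontal _ (by exact_mod_cast h.2.2.2)]
  simp [latticePoint, h.2.2.1]

theorem arcInterior_of_isVertical {e : G.edgeSet} {a b : V} (h : P.IsVertical e a b) :
    arcInterior (P.edgeArc e) =
      verticalSegment (P.pos a).1 (P.pos a).2 (P.pos b).2 := by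
  rw [P.arcInterior_edgeArc h.2.1, ← openSegment_vertical _ (by exact_mod_cast h.2.2.2)]
  simp [latticePoint, h.2.2.1]

theorem isHorizontal_or_isVertical (e : G.edgeSet) :
    (∃ a b, P.IsHorizontal e a b) ∨ ∃ a b, P.IsVertical e a b := by
  obtain ⟨e, he⟩ := e
  induction e using Sym2.ind with
  | _ a b =>
    have hab : G.Adj a b := he
    have hne : P.pos a ≠ P.pos b := fun h => hab.ne (P.pos_injective h)
    have hne' : (P.pos a).1 ≠ (P.pos b).1 ∨ (P.pos a).2 ≠ (P.pos b).2 := by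
      by_contra! h
      exact hne (Prod.ext h.1 h.2)
    rcases P.axis_parallel a b hab with h | h
    · rcases lt_trichotomy (P.pos a).1 (P.pos b).1 with h1 | h1 | h1
      · exact .inl ⟨a, b, hab, rfl, h, h1⟩
      · exact absurd h (hne'.resolve_left (not_not.2 h1))
      · exact .inl ⟨b, a, hab.symm, Sym2.eq_swap, h.symm, h1⟩
    · rcases lt_trichotomy (P.pos a).2 (P.pos b).2 with h1 | h1 | h1
      · exact .inr ⟨a, b, hab, rfl, h, h1⟩
      · exact absurd h (hne'.resolve_right (not_not.2 h1))
      · exact .inr ⟨b, a, hab.symm, Sym2.eq_swap, h.symm, h1⟩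

/-- Two overlapping collinear segments with different ends would have an end of one inside the
other, which the layout forbids. -/
theorem eq_of_isHorizontal {e f : G.edgeSet} {a b c d : V} {p : ℝ × ℝ}
    (he : P.IsHorizontal e a b) (hf : P.IsHorizontal f c d)
    (hpe : p ∈ arcInterior (P.edgeArc e)) (hpf : p ∈ arcInterior (P.edgeArc f)) : e = f := by
  rw [P.arcInterior_of_isHorizontal he] at hpe
  rw [P.arcInterior_of_isHorizontal hf] at hpf
  obtain ⟨hy, ha, hb⟩ := hpe
  obtain ⟨hy', hc, hd⟩ := hpf
  have hac : (P.pos a).2 = (P.pos c).2 := by exact_mod_cast hy.symm.trans hy'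
  have had : (P.pos a).1 < (P.pos d).1 := by exact_mod_cast ha.trans hd
  have hcb : (P.pos c).1 < (P.pos b).1 := by exact_mod_cast hc.trans hb
  have h1 := P.not_between_horizontal a b c he.1 he.2.2.1 hac.symm
  have h2 := P.not_between_horizontal c d a hf.1 hf.2.2.1 hac
  have h3 := P.not_between_horizontal a b d he.1 he.2.2.1 (hf.2.2.1.symm.trans hac.symm)
  have h4 := P.not_between_horizontal c d b hf.1 hf.2.2.1 (he.2.2.1.symm.trans hac)
  have e1 : a = c := P.pos_injective (Prod.ext (by omega) hac)
  have e2 : b = d := P.pos_injective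
    (Prod.ext (by omega) (he.2.2.1.symm.trans (hac.trans hf.2.2.1)))
  exact Subtype.ext (by rw [he.2.1, hf.2.1, e1, e2])

theorem eq_of_isVertical {e f : G.edgeSet} {a b c d : V} {p : ℝ × ℝ}
    (he : P.IsVertical e a b) (hf : P.IsVertical f c d)
    (hpe : p ∈ arcInterior (P.edgeArc e)) (hpf : p ∈ arcInterior (P.edgeArc f)) : e = f := by
  rw [P.arcInterior_of_isVertical he] at hpe
  rw [P.arcInterior_of_isVertical hf] at hpf
  obtain ⟨hy, ha, hb⟩ := hpe
  obtain ⟨hy', hc, hd⟩ := hpf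
  have hac : (P.pos a).1 = (P.pos c).1 := by exact_mod_cast hy.symm.trans hy'
  have had : (P.pos a).2 < (P.pos d).2 := by exact_mod_cast ha.trans hd
  have hcb : (P.pos c).2 < (P.pos b).2 := by exact_mod_cast hc.trans hb
  have h1 := P.not_between_vertical a b c he.1 he.2.2.1 hac.symm
  have h2 := P.not_between_vertical c d a hf.1 hf.2.2.1 hac
  have h3 := P.not_between_vertical a b d he.1 he.2.2.1 (hf.2.2.1.symm.trans hac.symm)
  have h4 := P.not_between_vertical c d b hf.1 hf.2.2.1 (he.2.2.1.symm.trans hac)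
  have e1 : a = c := P.pos_injective (Prod.ext hac (by omega))
  have e2 : b = d := P.pos_injective
    (Prod.ext (he.2.2.1.symm.trans (hac.trans hf.2.2.1)) (by omega))
  exact Subtype.ext (by rw [he.2.1, hf.2.1, e1, e2])

/-- The horizontal edge from `a` to `b` crosses the vertical edge from `c` to `d`. -/
def Crosses (a b c d : V) : Prop :=
  (P.pos a).1 < (P.pos c).1 ∧ (P.pos c).1 < (P.pos b).1 ∧
    (P.pos c).2 < (P.pos a).2 ∧ (P.pos a).2 < (P.pos d).2

theorem crosses_of_mem {e f : G.edgeSet} {a b c d : V} {p : ℝ × ℝ}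
    (he : P.IsHorizontal e a b) (hf : P.IsVertical f c d)
    (hpe : p ∈ arcInterior (P.edgeArc e)) (hpf : p ∈ arcInterior (P.edgeArc f)) :
    P.Crosses a b c d ∧ p = latticePoint ((P.pos c).1, (P.pos a).2) := by
  rw [P.arcInterior_of_isHorizontal he] at hpe
  rw [P.arcInterior_of_isVertical hf] at hpf
  obtain ⟨hy, ha, hb⟩ := hpe
  obtain ⟨hx, hc, hd⟩ := hpf
  rw [hx] at ha hb
  rw [hy] at hc hd
  exact ⟨⟨by exact_mod_cast ha, by exact_mod_cast hb, by exact_mod_cast hc,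
    by exact_mod_cast hd⟩, Prod.ext hx hy⟩

theorem isHorizontal_isVertical_of_mem {e f : G.edgeSet} {p : ℝ × ℝ} (hne : e ≠ f)
    (hpe : p ∈ arcInterior (P.edgeArc e)) (hpf : p ∈ arcInterior (P.edgeArc f)) :
    (∃ a b c d, P.IsHorizontal e a b ∧ P.IsVertical f c d) ∨
      ∃ a b c d, P.IsHorizontal f a b ∧ P.IsVertical e c d := by
  rcases P.isHorizontal_or_isVertical e with ⟨a, b, he⟩ | ⟨a, b, he⟩ <;>
    rcases P.isHorizontal_or_isVertical f with ⟨c, d, hf⟩ | ⟨c, d, hf⟩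
  · exact absurd (P.eq_of_isHorizontal he hf hpe hpf) hne
  · exact .inl ⟨a, b, c, d, he, hf⟩
  · exact .inr ⟨c, d, a, b, hf, he⟩
  · exact absurd (P.eq_of_isVertical he hf hpe hpf) hne

theorem crossProperlyAt {e f : G.edgeSet} {a b c d : V} {p : ℝ × ℝ}
    (he : P.IsHorizontal e a b) (hf : P.IsVertical f c d)
    (hpe : p ∈ arcInterior (P.edgeArc e)) (hpf : p ∈ arcInterior (P.edgeArc f)) :
    CrossProperlyAt (arcInterior (P.edgeArc e)) (arcInterior (P.edgeArc f)) p := by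
  obtain ⟨⟨h1, h2, h3, h4⟩, rfl⟩ := P.crosses_of_mem he hf hpe hpf
  rw [P.arcInterior_of_isHorizontal he, P.arcInterior_of_isVertical hf]
  exact crossProperlyAt_segments (by exact_mod_cast h1) (by exact_mod_cast h2)
    (by exact_mod_cast h3) (by exact_mod_cast h4)

theorem Crosses.notMem {a b c d v : V} (h : P.Crosses a b c d) (hab : (P.pos a).2 = (P.pos b).2)
    (hv : v ∈ s(a, b)) (hw : v ∈ s(c, d)) : False := by
  obtain ⟨h1, h2, h3, h4⟩ := h
  rcases Sym2.mem_iff.1 hv with rfl | rfl <;> rcases Sym2.mem_iff.1 hw with rfl | rfl <;> omega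

/-- The straight-line drawing that belongs to a grid layout. -/
noncomputable def drawing : G.PlaneDrawing where
  pos v := latticePoint (P.pos v)
  pos_injective := latticePoint_injective.comp P.pos_injective
  arc := P.edgeArc
  arc_injective e := by
    refine straightArc_injective fun h => ?_
    have h2 : s((Quot.out e.val).1, (Quot.out e.val).2) = e.val := Quot.out_eq e.val
    have h3 : G.Adj (Quot.out e.val).1 (Quot.out e.val).2 := by
      rw [← mem_edgeSet, h2]
      exact e.2
    exact h3.ne (P.pos_injective (latticePoint_injective h))
  arc_ends e := by
    have h2 : s((Quot.out e.val).1, (Quot.out e.val).2) = e.val := Quot.out_eq e.val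
    conv_rhs => rw [← h2]
    simp [edgeArc, straightArc]
  pos_notMem_arcInterior v e hv := by
    rcases P.isHorizontal_or_isVertical e with ⟨a, b, he⟩ | ⟨a, b, he⟩
    · rw [P.arcInterior_of_isHorizontal he] at hv
      obtain ⟨h1, h2, h3⟩ := hv
      simp only [latticePoint] at h1 h2 h3
      norm_cast at h1 h2 h3
      exact P.not_between_horizontal a b v he.1 he.2.2.1 h1 ⟨h2, h3⟩
    · rw [P.arcInterior_of_isVertical he] at hv
      obtain ⟨h1, h2, h3⟩ := hv
      simp only [latticePoint] at h1 h2 h3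
      norm_cast at h1 h2 h3
      exact P.not_between_vertical a b v he.1 he.2.2.1 h1 ⟨h2, h3⟩
  cross_properly e f p hne hpe hpf := by
    rcases P.isHorizontal_isVertical_of_mem hne hpe hpf with
      ⟨a, b, c, d, h1, h2⟩ | ⟨a, b, c, d, h1, h2⟩
    · exact P.crossProperlyAt h1 h2 hpe hpf
    · exact (P.crossProperlyAt h1 h2 hpf hpe).symm
  no_three_cross e f g p hef heg hfg := by
    rintro ⟨he, hf, hg⟩
    -- There are only two directions, so two of the three edges are parallel and hence equal.
    rcases P.isHorizontal_or_isVertical e with ⟨a, b, h1⟩ | ⟨a, b, h1⟩ <;>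
      rcases P.isHorizontal_or_isVertical f with ⟨c, d, h2⟩ | ⟨c, d, h2⟩ <;>
      rcases P.isHorizontal_or_isVertical g with ⟨a', b', h3⟩ | ⟨a', b', h3⟩
    · exact hef (P.eq_of_isHorizontal h1 h2 he hf)
    · exact hef (P.eq_of_isHorizontal h1 h2 he hf)
    · exact heg (P.eq_of_isHorizontal h1 h3 he hg)
    · exact hfg (P.eq_of_isVertical h2 h3 hf hg)
    · exact hfg (P.eq_of_isHorizontal h2 h3 hf hg)
    · exact heg (P.eq_of_isVertical h1 h3 he hg)
    · exact hef (P.eq_of_isVertical h1 h2 he hf)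
    · exact hef (P.eq_of_isVertical h1 h2 he hf)
  adjacent_not_cross e f v hne hve hvf := by
    rw [Set.disjoint_left]
    intro p hpe hpf
    rcases P.isHorizontal_isVertical_of_mem hne hpe hpf with
      ⟨a, b, c, d, h1, h2⟩ | ⟨a, b, c, d, h1, h2⟩
    · exact (P.crosses_of_mem h1 h2 hpe hpf).1.notMem P h1.2.2.1 (h1.2.1 ▸ hve) (h2.2.1 ▸ hvf)
    · exact (P.crosses_of_mem h1 h2 hpf hpe).1.notMem P h1.2.2.1 (h1.2.1 ▸ hvf) (h2.2.1 ▸ hve)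

/-- If every endpoint of a crossing determines the crossing, the drawing shows that the graph is
IC-planar. -/
theorem isICPlanar (c : V → ℤ × ℤ)
    (hc : ∀ u v w z, G.Adj u v → G.Adj w z → (P.pos u).2 = (P.pos v).2 →
      (P.pos w).1 = (P.pos z).1 → P.Crosses u v w z →
      ∀ x, x ∈ s(u, v) ∨ x ∈ s(w, z) → c x = ((P.pos w).1, (P.pos u).2)) :
    G.IsICPlanar := by
  -- An endpoint determines the crossing point; 1-planarity and independence are both instances of
  -- this.
  have key : ∀ p e f v, P.drawing.IsCrossing p e f → v ∈ (e : Sym2 V) →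
      p = latticePoint (c v) := by
    rintro p e f v ⟨hne, hpe, hpf⟩ hv
    rcases P.isHorizontal_isVertical_of_mem hne hpe hpf with
      ⟨a, b, a', b', h1, h2⟩ | ⟨a, b, a', b', h1, h2⟩
    · obtain ⟨h3, h4⟩ := P.crosses_of_mem h1 h2 hpe hpf
      rw [h4, hc a b a' b' h1.1 h2.1 h1.2.2.1 h2.2.2.1 h3 v (.inl (h1.2.1 ▸ hv))]
    · obtain ⟨h3, h4⟩ := P.crosses_of_mem h1 h2 hpf hpe
      rw [h4, hc a b a' b' h1.1 h2.1 h1.2.2.1 h2.2.2.1 h3 v (.inr (h2.2.1 ▸ hv))]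
  refine ⟨P.drawing, ?_, ?_⟩
  · intro e f g p q hp hq
    obtain ⟨v, hv⟩ : ∃ v, v ∈ (e : Sym2 V) := ⟨_, Sym2.out_fst_mem _⟩
    rw [key p e f v hp hv, key q e g v hq hv]
  · rintro p q v ⟨e, f, h, hv⟩ ⟨e', f', h', hv'⟩
    rw [key p e f v h hv, key q e' f' v h' hv']

end GridLayout

end OrthogonalDrawing

end SimpleGraph

namespace SimpleGraph

/-! ### Cycle space membership through weights of vertex pairs -/

section EdgeWeight

variable {V : Type*} (G : SimpleGraph V)

open Classical in
/-- The weights of the edges, as a function of two vertices which vanishes at nonadjacent pairs. -/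
noncomputable def adjWeight (x : G.edgeSet → ZMod 2) (v w : V) : ZMod 2 :=
  if h : G.Adj v w then x ⟨s(v, w), h⟩ else 0

variable {G}

theorem adjWeight_of_adj (x : G.edgeSet → ZMod 2) {v w : V} (h : G.Adj v w) :
    G.adjWeight x v w = x ⟨s(v, w), h⟩ := dif_pos h

theorem adjWeight_of_not_adj (x : G.edgeSet → ZMod 2) {v w : V} (h : ¬ G.Adj v w) :
    G.adjWeight x v w = 0 := dif_neg h

theorem adjWeight_comm (x : G.edgeSet → ZMod 2) (v w : V) :
    G.adjWeight x v w = G.adjWeight x w v := by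
  by_cases h : G.Adj v w
  · rw [adjWeight_of_adj x h, adjWeight_of_adj x h.symm]
    congr 2
    exact Sym2.eq_swap
  · rw [adjWeight_of_not_adj x h, adjWeight_of_not_adj x fun h' => h h'.symm]

theorem mem_cycleSpace_iff_adjWeight [Fintype V] (x : G.edgeSet → ZMod 2) :
    x ∈ G.cycleSpace ↔ ∀ v, ∑ w, G.adjWeight x v w = 0 := by
  classical
  change (∀ v : V, _ = _) ↔ _
  refine forall_congr' fun v => ?_
  suffices h : ∑ w, G.adjWeight x v w = ∑ e : G.edgeSet with v ∈ e.val, x e by rw [h]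
  rw [← Finset.sum_filter_of_ne (p := fun w => G.Adj v w)]
  · refine Finset.sum_bij (fun w hw => ⟨s(v, w), (Finset.mem_filter.1 hw).2⟩) ?_ ?_ ?_ ?_
    · simp
    · intro a _ b _ h
      exact Sym2.congr_right.1 (congrArg Subtype.val h)
    · rintro ⟨e, he⟩ hv
      obtain ⟨w, rfl⟩ : v ∈ e := by simpa using hv
      exact ⟨w, by simpa using he, rfl⟩
    · intro w hw
      exact adjWeight_of_adj x (Finset.mem_filter.1 hw).2
  · intro w _ hw
    by_contra h
    exact hw (adjWeight_of_not_adj x h)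

end EdgeWeight

/-! ### The grid graph of a multigraph and its IC-planar layout -/

section GridGraph

/-- The kinds of nodes in a tile of the grid graph. -/
inductive Port
  | left | right | down | up | center
  deriving DecidableEq

instance : Fintype Port := ⟨{.left, .right, .down, .up, .center}, by rintro ⟨⟩ <;> simp⟩

/-- The nodes of the grid graph with `m` columns and `n` rows. -/
abbrev GridNode (m n : ℕ) : Type := Fin m × Fin n × Port

variable {m n : ℕ} (s t : Fin m → Fin n)

/-- The edges of the grid graph, directed to the right or upwards. -/
inductive GridLink : GridNode m n → GridNode m n → Prop
  | rowOut {e e' v} : e'.val = e.val + 1 → GridLink (e, v, .right) (e', v, .left)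
  -- Columns run through all rows. The pieces below `s e` and above `t e` are detached paths when `s
  -- e < t e`, so they carry no cycle.
  | colOut {e v v'} : v'.val = v.val + 1 → GridLink (e, v, .up) (e, v', .down)
  | rowCross {e v} : v ≠ s e → v ≠ t e → GridLink (e, v, .left) (e, v, .right)
  | colCross {e v} : v ≠ s e → v ≠ t e → GridLink (e, v, .down) (e, v, .up)
  | left {e v} : v = s e ∨ v = t e → GridLink (e, v, .left) (e, v, .center)
  | right {e v} : v = s e ∨ v = t e → GridLink (e, v, .center) (e, v, .right)
  | up {e v} : v = s e → GridLink (e, v, .center) (e, v, .up)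
  | down {e v} : v = t e → GridLink (e, v, .down) (e, v, .center)

/-- The grid graph of a multigraph with vertex set `Fin n` and edge set `Fin m`, where the edge `e`
leads from `s e` to `t e`. Vertices become rows and edges become columns. -/
def gridGraph : SimpleGraph (GridNode m n) where
  Adj a b := GridLink s t a b ∨ GridLink s t b a
  symm := ⟨fun _ _ h => h.symm⟩
  loopless := ⟨by
    rintro ⟨e, v, p⟩ (h | h) <;> cases h⟩

variable {s t}

/-- The position of a node. The centers of the tiles that have a crossing are isolated nodes,
which are moved away from the crossing. -/
def gridPos (s t : Fin m → Fin n) : GridNode m n → ℤ × ℤ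
  | (e, v, .left) => (4 * e - 1, 4 * v)
  | (e, v, .right) => (4 * e + 1, 4 * v)
  | (e, v, .down) => (4 * e, 4 * v - 1)
  | (e, v, .up) => (4 * e, 4 * v + 1)
  | (e, v, .center) => if v = s e ∨ v = t e then (4 * e, 4 * v) else (4 * e + 1, 4 * v + 1)

theorem gridPos_injective : Function.Injective (gridPos s t) := by
  rintro ⟨e, v, p⟩ ⟨e', v', p'⟩ h
  suffices e.val = e'.val ∧ v.val = v'.val ∧ p = p' by
    simpa [Fin.ext_iff] using this
  by_cases h1 : v = s e ∨ v = t e <;> by_cases h2 : v' = s e' ∨ v' = t e' <;>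
    cases p <;> cases p' <;>
    simp only [gridPos, h1, h2, if_true, if_false, Prod.mk.injEq, reduceCtorEq, and_true,
      and_false] at h ⊢ <;> omega

theorem GridLink.axis_parallel {a b : GridNode m n} (h : GridLink s t a b) :
    ((gridPos s t a).2 = (gridPos s t b).2 ∧ (gridPos s t a).1 < (gridPos s t b).1) ∨
      ((gridPos s t a).1 = (gridPos s t b).1 ∧ (gridPos s t a).2 < (gridPos s t b).2) := by
  cases h <;> simp_all [gridPos] <;> omega

/-- Links between tiles have length 2, and their midpoint has a coordinate congruent to 2 modulo 4,
which no node has. Links at a center have length 1. A crossing link passes only the middle of its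
tile, and that tile's center has been moved away. -/
theorem GridLink.not_between {a b c : GridNode m n} (h : GridLink s t a b) :
    ((gridPos s t a).2 = (gridPos s t b).2 → (gridPos s t c).2 = (gridPos s t a).2 →
      ¬ ((gridPos s t a).1 < (gridPos s t c).1 ∧ (gridPos s t c).1 < (gridPos s t b).1)) ∧
    ((gridPos s t a).1 = (gridPos s t b).1 → (gridPos s t c).1 = (gridPos s t a).1 →
      ¬ ((gridPos s t a).2 < (gridPos s t c).2 ∧ (gridPos s t c).2 < (gridPos s t b).2)) := by
  obtain ⟨e', v', p⟩ := c
  by_cases h2 : v' = s e' ∨ v' = t e'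
  · have key : ∀ e v, v ≠ s e → v ≠ t e → ¬ (e'.val = e.val ∧ v'.val = v.val) := by
      rintro e v hs ht ⟨he, hv⟩
      obtain rfl := Fin.ext he
      obtain rfl := Fin.ext hv
      exact h2.elim hs ht
    cases h with
    | rowOut h => cases p <;> simp only [gridPos, h2, if_true] <;> omega
    | colOut h => cases p <;> simp only [gridPos, h2, if_true] <;> omega
    | rowCross hs ht => have := key _ _ hs ht; cases p <;> simp only [gridPos, h2, if_true] <;> omega
    | colCross hs ht => have := key _ _ hs ht; cases p <;> simp only [gridPos, h2, if_true] <;> omega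
    | left h => cases p <;> simp only [gridPos, h, h2, if_true] <;> omega
    | right h => cases p <;> simp only [gridPos, h, h2, if_true] <;> omega
    | up h => cases p <;> simp only [gridPos, h, h2, true_or, if_true] <;> omega
    | down h => cases p <;> simp only [gridPos, h, h2, or_true, if_true] <;> omega
  · cases h with
    | rowOut h => cases p <;> simp only [gridPos, h2, if_false] <;> omega
    | colOut h => cases p <;> simp only [gridPos, h2, if_false] <;> omega
    | rowCross hs ht => cases p <;> simp only [gridPos, h2, if_false] <;> omega
    | colCross hs ht => cases p <;> simp only [gridPos, h2, if_false] <;> omega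
    | left h => cases p <;> simp only [gridPos, h, h2, if_true, if_false] <;> omega
    | right h => cases p <;> simp only [gridPos, h, h2, if_true, if_false] <;> omega
    | up h => cases p <;> simp only [gridPos, h, h2, true_or, if_true, if_false] <;> omega
    | down h => cases p <;> simp only [gridPos, h, h2, or_true, if_true, if_false] <;> omega

variable (s t) in
/-- The layout of the grid graph. -/
def gridLayout : (gridGraph s t).GridLayout where
  pos := gridPos s t
  pos_injective := gridPos_injective
  axis_parallel a b h := by
    rcases h with h | h <;> rcases h.axis_parallel with h | h <;> simp [h.1]
  not_between_horizontal a b c h hab hc := by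
    rcases h with h | h
    · exact (h.not_between (c := c)).1 hab hc
    · rcases h.axis_parallel with h1 | h1
      · omega
      · omega
  not_between_vertical a b c h hab hc := by
    rcases h with h | h
    · exact (h.not_between (c := c)).2 hab hc
    · rcases h.axis_parallel with h1 | h1
      · omega
      · omega

/-- The middle of the tile of a node. -/
def tileCenter : GridNode m n → ℤ × ℤ
  | (e, v, _) => (4 * e, 4 * v)

/-- Only `rowCross` and `colCross` of the same tile can cross. The crossing is the middle of that
tile, and all four ends are ports of it. -/
theorem GridLink.eq_of_crosses {a b c d : GridNode m n} (h : GridLink s t a b)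
    (h' : GridLink s t c d) (hc : (gridLayout s t).Crosses a b c d)
    (hab : (gridPos s t a).2 = (gridPos s t b).2) (hcd : (gridPos s t c).1 = (gridPos s t d).1) :
    ∀ x, x ∈ s(a, b) ∨ x ∈ s(c, d) →
      tileCenter x = ((gridPos s t c).1, (gridPos s t a).2) := by
  obtain ⟨h1, h2, h3, h4⟩ := hc
  simp only [gridLayout] at h1 h2 h3 h4
  cases h <;> cases h' <;> simp only [gridPos] at h1 h2 h3 h4 hab hcd <;>
    first
    | (exfalso; split_ifs at * <;> omega)
    | (simp only [Sym2.mem_iff, gridPos]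
       rintro x ((rfl | rfl) | (rfl | rfl)) <;> refine Prod.ext ?_ ?_ <;>
         simp only [tileCenter] <;> omega)

theorem gridGraph_isICPlanar : (gridGraph s t).IsICPlanar := by
  refine (gridLayout s t).isICPlanar tileCenter ?_
  intro a b c d hab hcd h1 h2 hc
  have h3 : (gridPos s t a).1 < (gridPos s t b).1 := hc.1.trans hc.2.1
  have h4 : (gridPos s t c).2 < (gridPos s t d).2 := hc.2.2.1.trans hc.2.2.2
  rcases hab with h | h
  · rcases hcd with h' | h'
    · exact h.eq_of_crosses h' hc h1 h2
    · rcases h'.axis_parallel with h5 | h5 <;> simp only [gridLayout] at * <;> omega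
  · rcases h.axis_parallel with h5 | h5 <;> simp only [gridLayout] at * <;> omega

end GridGraph

end SimpleGraph

namespace SimpleGraph

/-! ### Degrees, port weights and vertex sums in the grid graph -/

section GridGraph

variable {m n : ℕ} {s t : Fin m → Fin n}

theorem gridGraph_adj_left {e : Fin m} {v : Fin n} {w : GridNode m n}
    (h : (gridGraph s t).Adj (e, v, .left) w) :
    w = (e, v, .center) ∨ w = (e, v, .right) ∨
      ∃ e' : Fin m, e.val = e'.val + 1 ∧ w = (e', v, .right) := by
  rcases h with h | h <;> cases h <;> simp_all

theorem gridGraph_adj_right {e : Fin m} {v : Fin n} {w : GridNode m n}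
    (h : (gridGraph s t).Adj (e, v, .right) w) :
    w = (e, v, .center) ∨ w = (e, v, .left) ∨
      ∃ e' : Fin m, e'.val = e.val + 1 ∧ w = (e', v, .left) := by
  rcases h with h | h <;> cases h <;> simp_all

theorem gridGraph_adj_down {e : Fin m} {v : Fin n} {w : GridNode m n}
    (h : (gridGraph s t).Adj (e, v, .down) w) :
    w = (e, v, .center) ∨ w = (e, v, .up) ∨
      ∃ v' : Fin n, v.val = v'.val + 1 ∧ w = (e, v', .up) := by
  rcases h with h | h <;> cases h <;> simp_all

theorem gridGraph_adj_up {e : Fin m} {v : Fin n} {w : GridNode m n}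
    (h : (gridGraph s t).Adj (e, v, .up) w) :
    w = (e, v, .center) ∨ w = (e, v, .down) ∨
      ∃ v' : Fin n, v'.val = v.val + 1 ∧ w = (e, v', .down) := by
  rcases h with h | h <;> cases h <;> simp_all

theorem gridGraph_adj_center {e : Fin m} {v : Fin n} {w : GridNode m n}
    (h : (gridGraph s t).Adj (e, v, .center) w) :
    (v = s e ∨ v = t e) ∧ (w = (e, v, .left) ∨ w = (e, v, .right) ∨
      (v = s e ∧ w = (e, v, .up)) ∨ (v = t e ∧ w = (e, v, .down))) := by
  rcases h with h | h <;> cases h <;> simp_all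

theorem gridGraph_exists_neighbors (hst : ∀ e, s e ≠ t e) (a : GridNode m n) :
    ∃ x y z, ∀ w, (gridGraph s t).Adj a w → w = x ∨ w = y ∨ w = z := by
  -- A port has at most one neighbor outside its tile; at the border an arbitrary index fills the
  -- slot.
  have outer : ∀ {k : ℕ} (p : Fin k → Prop), (∀ i j, p i → p j → i = j) → Nonempty (Fin k) →
      ∃ i, ∀ j, p j → j = i := by
    intro k p hp ⟨i₀⟩
    by_cases h : ∃ i, p i
    · exact ⟨h.choose, fun j hj => hp _ _ hj h.choose_spec⟩
    · exact ⟨i₀, fun j hj => absurd ⟨j, hj⟩ h⟩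
  obtain ⟨e, v, p⟩ := a
  cases p with
  | left =>
    obtain ⟨i, hi⟩ := outer (fun e' : Fin m => e.val = e'.val + 1) (by intros; omega) ⟨e⟩
    refine ⟨(e, v, .center), (e, v, .right), (i, v, .right), fun w hw => ?_⟩
    rcases gridGraph_adj_left hw with h | h | ⟨e', he, h⟩
    · exact .inl h
    · exact .inr (.inl h)
    · exact .inr (.inr (hi e' he ▸ h))
  | right =>
    obtain ⟨i, hi⟩ := outer (fun e' : Fin m => e'.val = e.val + 1) (by intros; omega) ⟨e⟩
    refine ⟨(e, v, .center), (e, v, .left), (i, v, .left), fun w hw => ?_⟩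
    rcases gridGraph_adj_right hw with h | h | ⟨e', he, h⟩
    · exact .inl h
    · exact .inr (.inl h)
    · exact .inr (.inr (hi e' he ▸ h))
  | down =>
    obtain ⟨i, hi⟩ := outer (fun v' : Fin n => v.val = v'.val + 1) (by intros; omega) ⟨v⟩
    refine ⟨(e, v, .center), (e, v, .up), (e, i, .up), fun w hw => ?_⟩
    rcases gridGraph_adj_down hw with h | h | ⟨v', hv, h⟩
    · exact .inl h
    · exact .inr (.inl h)
    · exact .inr (.inr (hi v' hv ▸ h))
  | up =>
    obtain ⟨i, hi⟩ := outer (fun v' : Fin n => v'.val = v.val + 1) (by intros; omega) ⟨v⟩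
    refine ⟨(e, v, .center), (e, v, .down), (e, i, .down), fun w hw => ?_⟩
    rcases gridGraph_adj_up hw with h | h | ⟨v', hv, h⟩
    · exact .inl h
    · exact .inr (.inl h)
    · exact .inr (.inr (hi v' hv ▸ h))
  | center =>
    refine ⟨(e, v, .left), (e, v, .right), (e, v, if v = s e then .up else .down),
      fun w hw => ?_⟩
    have := hst e
    obtain ⟨-, h | h | ⟨h, h'⟩ | ⟨h, h'⟩⟩ := gridGraph_adj_center hw
    · exact .inl h
    · exact .inr (.inl h)
    · simp [h, h']
    · simp [h, h', this.symm]

theorem gridGraph_maxDegree [DecidableRel (gridGraph s t).Adj] (hst : ∀ e, s e ≠ t e)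
    (hm : 0 < m) : (gridGraph s t).maxDegree = 3 := by
  refine le_antisymm (maxDegree_le_of_forall_degree_le _ _ fun a => ?_) ?_
  · obtain ⟨x, y, z, h⟩ := gridGraph_exists_neighbors hst a
    rw [← card_neighborFinset_eq_degree]
    refine (Finset.card_le_card (t := {x, y, z}) fun w hw => ?_).trans Finset.card_le_three
    simpa using h w (by simpa using hw)
  · let e : Fin m := ⟨0, hm⟩
    refine le_trans ?_ ((gridGraph s t).degree_le_maxDegree (e, s e, .center))
    rw [← card_neighborFinset_eq_degree]
    have : ({(e, s e, .left), (e, s e, .right), (e, s e, .up)} : Finset (GridNode m n)).card = 3 :=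
      by simp
    rw [← this]
    refine Finset.card_le_card fun w hw => ?_
    simp only [Finset.mem_insert, Finset.mem_singleton] at hw
    rw [mem_neighborFinset]
    rcases hw with rfl | rfl | rfl
    · exact .inr (.left (.inl rfl))
    · exact .inl (.right (.inl rfl))
    · exact .inl (.up rfl)

/-- The even edge sets of the multigraph with vertex set `Fin n` in which the edge `e` leads from
`s e` to `t e`. -/
def IsEven (s t : Fin m → Fin n) (y : Fin m → ZMod 2) : Prop :=
  ∀ v, ∑ e with v = s e ∨ v = t e, y e = 0

/-- The weights at the ports of the grid graph of the member of the cycle space that belongs to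
an even edge set of the multigraph. -/
def portWeight (s t : Fin m → Fin n) (y : Fin m → ZMod 2) : GridNode m n → ZMod 2
  -- These values are forced by parity: a row starts with weight 0 and changes by `y e'` at each
  -- incident column, while a column carries its weight only between its two ends.
  | (e, v, .left) => ∑ e' with e' < e ∧ (v = s e' ∨ v = t e'), y e'
  | (e, v, .right) => ∑ e' with e' ≤ e ∧ (v = s e' ∨ v = t e'), y e'
  | (e, v, .down) => if s e < v ∧ v ≤ t e then y e else 0
  | (e, v, .up) => if s e ≤ v ∧ v < t e then y e else 0
  | (_, _, .center) => 0

theorem portWeight_zero (a : GridNode m n) : portWeight s t 0 a = 0 := by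
  rcases a with ⟨e, v, _ | _ | _ | _ | _⟩ <;> simp [portWeight]

theorem portWeight_left_of_eq_zero (y : Fin m → ZMod 2) {e : Fin m} (v : Fin n)
    (he : e.val = 0) : portWeight s t y (e, v, .left) = 0 := by
  simp [portWeight, Fin.lt_def, he]

theorem portWeight_right_eq_left (y : Fin m → ZMod 2) {e e' : Fin m} (v : Fin n)
    (he : e'.val = e.val + 1) :
    portWeight s t y (e, v, .right) = portWeight s t y (e', v, .left) := by
  have h : ∀ i : Fin m, i ≤ e ↔ i < e' := fun i => by rw [Fin.le_def, Fin.lt_def]; omega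
  simp only [portWeight, h]

/-- At the last column the prefix sum is the full sum at `v`, so evenness is exactly what lets the
row end there. -/
theorem portWeight_right_of_last {y : Fin m → ZMod 2} (hy : IsEven s t y) {e : Fin m} (v : Fin n)
    (he : e.val + 1 = m) : portWeight s t y (e, v, .right) = 0 := by
  have h : ∀ e' : Fin m, e' ≤ e := fun e' => by rw [Fin.le_def]; omega
  simpa [portWeight, h] using hy v

theorem portWeight_right (y : Fin m → ZMod 2) (e : Fin m) (v : Fin n) :
    portWeight s t y (e, v, .right) =
      portWeight s t y (e, v, .left) + if v = s e ∨ v = t e then y e else 0 := by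
  simp only [portWeight]
  split_ifs with h
  · have : (Finset.univ.filter fun e' => e' ≤ e ∧ (v = s e' ∨ v = t e')) =
        insert e (Finset.univ.filter fun e' => e' < e ∧ (v = s e' ∨ v = t e')) := by
      ext e'
      simp only [Finset.mem_filter, Finset.mem_univ, true_and, Finset.mem_insert, le_iff_eq_or_lt]
      constructor
      · rintro ⟨h1 | h1, h2⟩
        · exact .inl h1
        · exact .inr ⟨h1, h2⟩
      · rintro (rfl | ⟨h1, h2⟩)
        · exact ⟨.inl rfl, h⟩
        · exact ⟨.inr h1, h2⟩
    rw [this, Finset.sum_insert (by simp), add_comm]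
  · rw [add_zero]
    refine Finset.sum_congr (Finset.filter_congr fun e' _ => ?_) fun _ _ => rfl
    constructor
    · rintro ⟨h1, h2⟩
      exact ⟨lt_of_le_of_ne h1 (by rintro rfl; exact h h2), h2⟩
    · rintro ⟨h1, h2⟩
      exact ⟨h1.le, h2⟩

theorem portWeight_up_eq_down (y : Fin m → ZMod 2) {v v' : Fin n} (e : Fin m)
    (hv : v'.val = v.val + 1) :
    portWeight s t y (e, v, .up) = portWeight s t y (e, v', .down) := by
  have h1 : s e ≤ v ↔ s e < v' := by rw [Fin.le_def, Fin.lt_def]; omega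
  have h2 : v < t e ↔ v' ≤ t e := by rw [Fin.le_def, Fin.lt_def]; omega
  simp only [portWeight, h1, h2]

/-- The sum of the two edges from a port into its tile. -/
noncomputable def innerWeight (x : (gridGraph s t).edgeSet → ZMod 2) (e : Fin m) (v : Fin n)
    (p q : Port) : ZMod 2 :=
  (gridGraph s t).adjWeight x (e, v, p) (e, v, .center) +
    (gridGraph s t).adjWeight x (e, v, p) (e, v, q)

theorem sum_two {α : Type*} [Fintype α] [DecidableEq α] {f : α → ZMod 2} {a b : α} (hab : a ≠ b)
    (h : ∀ w, f w ≠ 0 → w = a ∨ w = b) : ∑ w, f w = f a + f b := by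
  rw [← Finset.sum_pair hab]
  refine (Finset.sum_subset (Finset.subset_univ _) fun w _ hw => ?_).symm
  by_contra h0
  exact hw (by simpa using h w h0)

theorem sum_three {α : Type*} [Fintype α] [DecidableEq α] {f : α → ZMod 2} {a b c : α}
    (hab : a ≠ b) (hac : a ≠ c) (hbc : b ≠ c)
    (h : ∀ w, f w ≠ 0 → w = a ∨ w = b ∨ w = c) : ∑ w, f w = f a + f b + f c := by
  have := Finset.sum_subset (Finset.subset_univ {a, b, c}) (f := f) fun w _ hw => by
    by_contra h0
    exact hw (by simpa using h w h0)
  rw [← this, Finset.sum_insert (by simp [hab, hac]), Finset.sum_pair hbc, add_assoc]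

theorem adj_of_adjWeight_ne_zero {V : Type*} {G : SimpleGraph V} {x : G.edgeSet → ZMod 2} {v w : V}
    (h : G.adjWeight x v w ≠ 0) : G.Adj v w := by
  by_contra h'
  exact h (adjWeight_of_not_adj x h')

variable (x : (gridGraph s t).edgeSet → ZMod 2)

theorem sum_left_of_eq_zero {e : Fin m} (v : Fin n) (he : e.val = 0) :
    ∑ w, (gridGraph s t).adjWeight x (e, v, .left) w = innerWeight x e v .left .right := by
  refine sum_two (by simp) fun w hw => ?_
  rcases gridGraph_adj_left (adj_of_adjWeight_ne_zero hw) with h | h | ⟨e', h', -⟩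
  · exact .inl h
  · exact .inr h
  · omega

theorem sum_left {e e' : Fin m} (v : Fin n) (he : e.val = e'.val + 1) :
    ∑ w, (gridGraph s t).adjWeight x (e, v, .left) w = innerWeight x e v .left .right +
      (gridGraph s t).adjWeight x (e, v, .left) (e', v, .right) := by
  refine sum_three (by simp) (by simp) (by simp [Fin.ext_iff]; omega) fun w hw => ?_
  rcases gridGraph_adj_left (adj_of_adjWeight_ne_zero hw) with h | h | ⟨e'', h', h⟩
  · exact .inl h
  · exact .inr (.inl h)
  · obtain rfl : e' = e'' := by omega
    exact .inr (.inr h)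

theorem sum_right_of_last {e : Fin m} (v : Fin n) (he : e.val + 1 = m) :
    ∑ w, (gridGraph s t).adjWeight x (e, v, .right) w = innerWeight x e v .right .left := by
  refine sum_two (by simp) fun w hw => ?_
  rcases gridGraph_adj_right (adj_of_adjWeight_ne_zero hw) with h | h | ⟨e', h', -⟩
  · exact .inl h
  · exact .inr h
  · omega

theorem sum_right {e e' : Fin m} (v : Fin n) (he : e'.val = e.val + 1) :
    ∑ w, (gridGraph s t).adjWeight x (e, v, .right) w = innerWeight x e v .right .left +
      (gridGraph s t).adjWeight x (e, v, .right) (e', v, .left) := by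
  refine sum_three (by simp) (by simp) (by simp [Fin.ext_iff]; omega) fun w hw => ?_
  rcases gridGraph_adj_right (adj_of_adjWeight_ne_zero hw) with h | h | ⟨e'', h', h⟩
  · exact .inl h
  · exact .inr (.inl h)
  · obtain rfl : e' = e'' := by omega
    exact .inr (.inr h)

theorem sum_down_of_eq_zero (e : Fin m) {v : Fin n} (hv : v.val = 0) :
    ∑ w, (gridGraph s t).adjWeight x (e, v, .down) w = innerWeight x e v .down .up := by
  refine sum_two (by simp) fun w hw => ?_
  rcases gridGraph_adj_down (adj_of_adjWeight_ne_zero hw) with h | h | ⟨e', h', -⟩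
  · exact .inl h
  · exact .inr h
  · omega

theorem sum_down (e : Fin m) {v v' : Fin n} (hv : v.val = v'.val + 1) :
    ∑ w, (gridGraph s t).adjWeight x (e, v, .down) w = innerWeight x e v .down .up +
      (gridGraph s t).adjWeight x (e, v, .down) (e, v', .up) := by
  refine sum_three (by simp) (by simp) (by simp [Fin.ext_iff]; omega) fun w hw => ?_
  rcases gridGraph_adj_down (adj_of_adjWeight_ne_zero hw) with h | h | ⟨v'', h', h⟩
  · exact .inl h
  · exact .inr (.inl h)
  · obtain rfl : v' = v'' := by omega
    exact .inr (.inr h)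

theorem sum_up_of_last (e : Fin m) {v : Fin n} (hv : v.val + 1 = n) :
    ∑ w, (gridGraph s t).adjWeight x (e, v, .up) w = innerWeight x e v .up .down := by
  refine sum_two (by simp) fun w hw => ?_
  rcases gridGraph_adj_up (adj_of_adjWeight_ne_zero hw) with h | h | ⟨e', h', -⟩
  · exact .inl h
  · exact .inr h
  · omega

theorem sum_up (e : Fin m) {v v' : Fin n} (hv : v'.val = v.val + 1) :
    ∑ w, (gridGraph s t).adjWeight x (e, v, .up) w = innerWeight x e v .up .down +
      (gridGraph s t).adjWeight x (e, v, .up) (e, v', .down) := by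
  refine sum_three (by simp) (by simp) (by simp [Fin.ext_iff]; omega) fun w hw => ?_
  rcases gridGraph_adj_up (adj_of_adjWeight_ne_zero hw) with h | h | ⟨v'', h', h⟩
  · exact .inl h
  · exact .inr (.inl h)
  · obtain rfl : v' = v'' := by omega
    exact .inr (.inr h)

theorem not_adj_of_incident {e : Fin m} {v : Fin n} (h : v = s e ∨ v = t e) {p q : Port}
    (hp : p ≠ .center) (hq : q ≠ .center) : ¬ (gridGraph s t).Adj (e, v, p) (e, v, q) := by
  rintro (h' | h') <;> cases h' <;> simp_all

theorem not_adj_center_of_not_incident {e : Fin m} {v : Fin n} (h : ¬ (v = s e ∨ v = t e))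
    (w : GridNode m n) : ¬ (gridGraph s t).Adj (e, v, .center) w :=
  fun h' => h (gridGraph_adj_center h').1

/-- At most one summand of `innerWeight` comes from an edge, depending on the kind of tile, so both
kinds share the same parity equations at the ports. -/
theorem innerWeight_of_incident {e : Fin m} {v : Fin n} (h : v = s e ∨ v = t e) {p q : Port}
    (hp : p ≠ .center) (hq : q ≠ .center) :
    innerWeight x e v p q = (gridGraph s t).adjWeight x (e, v, p) (e, v, .center) := by
  rw [innerWeight, adjWeight_of_not_adj x (not_adj_of_incident h hp hq), add_zero]

theorem innerWeight_of_not_incident {e : Fin m} {v : Fin n} (h : ¬ (v = s e ∨ v = t e))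
    (p q : Port) :
    innerWeight x e v p q = (gridGraph s t).adjWeight x (e, v, p) (e, v, q) := by
  rw [innerWeight, adjWeight_comm x _ (e, v, .center),
    adjWeight_of_not_adj x (not_adj_center_of_not_incident h _), zero_add]

theorem sum_center {e : Fin m} {v : Fin n} (h : v = s e ∨ v = t e) :
    ∑ w, (gridGraph s t).adjWeight x (e, v, .center) w =
      innerWeight x e v .left .right + innerWeight x e v .right .left +
        (innerWeight x e v .down .up + innerWeight x e v .up .down) := by
  have := Finset.sum_subset (f := fun w => (gridGraph s t).adjWeight x (e, v, .center) w)
    (Finset.subset_univ {(e, v, .left), (e, v, .right), (e, v, .down), (e, v, .up)})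
    fun w _ hw => by
      by_contra h0
      have := (gridGraph_adj_center (adj_of_adjWeight_ne_zero h0)).2
      simp only [Finset.mem_insert, Finset.mem_singleton] at hw
      tauto
  rw [← this, innerWeight_of_incident x h (by simp) (by simp),
    innerWeight_of_incident x h (by simp) (by simp),
    innerWeight_of_incident x h (by simp) (by simp),
    innerWeight_of_incident x h (by simp) (by simp)]
  simp only [adjWeight_comm x _ (e, v, .center)]
  simp [Finset.sum_insert, add_assoc]

theorem sum_center_of_not_incident {e : Fin m} {v : Fin n} (h : ¬ (v = s e ∨ v = t e)) :
    ∑ w, (gridGraph s t).adjWeight x (e, v, .center) w = 0 :=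
  Finset.sum_eq_zero fun w _ => adjWeight_of_not_adj x (not_adj_center_of_not_incident h w)

theorem innerWeight_down_of_eq_s {e : Fin m} (hst : s e ≠ t e) :
    innerWeight x e (s e) .down .up = 0 := by
  rw [innerWeight_of_incident x (.inl rfl) (by simp) (by simp)]
  refine adjWeight_of_not_adj x ?_
  rintro (h | h) <;> cases h
  contradiction

theorem innerWeight_up_of_eq_t {e : Fin m} (hst : s e ≠ t e) :
    innerWeight x e (t e) .up .down = 0 := by
  rw [innerWeight_of_incident x (.inr rfl) (by simp) (by simp)]
  refine adjWeight_of_not_adj x ?_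
  rintro (h | h) <;> cases h
  exact hst (Eq.symm ‹_›)

end GridGraph

end SimpleGraph

namespace SimpleGraph

/-! ### The cycle space of the grid graph and the even sets of the multigraph -/

section GridGraph

variable {m n : ℕ} {s t : Fin m → Fin n}

variable (s t) in
/-- The edge that represents an edge `e` of the multigraph in the grid graph. -/
def repEdge (e : Fin m) : (gridGraph s t).edgeSet :=
  ⟨s((e, s e, .center), (e, s e, .up)), .inl (.up rfl)⟩

theorem portWeight_down_add_up {e : Fin m} (hst : s e < t e) (y : Fin m → ZMod 2) {v : Fin n}
    (hv : v = s e ∨ v = t e) :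
    portWeight s t y (e, v, .down) + portWeight s t y (e, v, .up) = y e := by
  rcases hv with rfl | rfl <;> simp [portWeight, hst]

theorem portWeight_down_eq_up_of_not_incident {e : Fin m} (y : Fin m → ZMod 2) {v : Fin n}
    (hv : ¬ (v = s e ∨ v = t e)) :
    portWeight s t y (e, v, .down) = portWeight s t y (e, v, .up) := by
  have h1 : s e < v ↔ s e ≤ v := by rw [Fin.le_def, Fin.lt_def]; omega
  have h2 : v ≤ t e ↔ v < t e := by rw [Fin.le_def, Fin.lt_def]; omega
  simp only [portWeight, h1, h2]

section Member

variable {x : (gridGraph s t).edgeSet → ZMod 2}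

/-- Parity at the ports propagates the weight up the column. It is 0 at the bottom, restarts with
the representative edge at `s e`, and stops at `t e`, where the center has no upward edge. -/
theorem innerWeight_down_and_up (hst : ∀ e, s e < t e) (hx : x ∈ (gridGraph s t).cycleSpace)
    (e : Fin m) (v : Fin n) :
    innerWeight x e v .down .up = portWeight s t (x ∘ repEdge s t) (e, v, .down) ∧
      innerWeight x e v .up .down = portWeight s t (x ∘ repEdge s t) (e, v, .up) := by
  rw [mem_cycleSpace_iff_adjWeight] at hx
  have up_of_down : ∀ v,
      innerWeight x e v .down .up = portWeight s t (x ∘ repEdge s t) (e, v, .down) →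
      innerWeight x e v .up .down = portWeight s t (x ∘ repEdge s t) (e, v, .up) := by
    intro v h
    by_cases hv : v = s e ∨ v = t e
    · rcases hv with rfl | rfl
      · rw [innerWeight_of_incident x (.inl rfl) (by simp) (by simp), adjWeight_comm,
          adjWeight_of_adj x (.inl (.up rfl))]
        simp [portWeight, hst e, repEdge]
      · rw [innerWeight_up_of_eq_t x (hst e).ne]
        simp [portWeight]
    · rw [← portWeight_down_eq_up_of_not_incident _ hv, ← h, innerWeight_of_not_incident x hv,
        innerWeight_of_not_incident x hv, adjWeight_comm]
  obtain ⟨k, hk⟩ := v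
  induction k with
  | zero =>
    refine (fun h => ⟨h, up_of_down _ h⟩) ?_
    rw [← sum_down_of_eq_zero x e (v := ⟨0, hk⟩) rfl, hx]
    simp [portWeight, Fin.lt_def]
  | succ k ih =>
    refine (fun h => ⟨h, up_of_down _ h⟩) ?_
    have h1 := sum_down x e (v := ⟨k + 1, hk⟩) (v' := ⟨k, by omega⟩) rfl
    have h2 := sum_up x e (v := ⟨k, by omega⟩) (v' := ⟨k + 1, hk⟩) rfl
    rw [hx, eq_comm, CharTwo.add_eq_zero] at h1 h2
    rw [h1, adjWeight_comm, ← h2, (ih _).2]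
    exact portWeight_up_eq_down _ e rfl

/-- The same propagation from left to right. Parity at an incident center adds the weight of its
column, which is already known. -/
theorem innerWeight_left_and_right (hst : ∀ e, s e < t e) (hx : x ∈ (gridGraph s t).cycleSpace)
    (e : Fin m) (v : Fin n) :
    innerWeight x e v .left .right = portWeight s t (x ∘ repEdge s t) (e, v, .left) ∧
      innerWeight x e v .right .left = portWeight s t (x ∘ repEdge s t) (e, v, .right) := by
  have hcol := fun e v => innerWeight_down_and_up hst hx e v
  rw [mem_cycleSpace_iff_adjWeight] at hx
  have right_of_left : ∀ e,
      innerWeight x e v .left .right = portWeight s t (x ∘ repEdge s t) (e, v, .left) →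
      innerWeight x e v .right .left = portWeight s t (x ∘ repEdge s t) (e, v, .right) := by
    intro e h
    rw [portWeight_right, ← h]
    split_ifs with hv
    · have h1 := sum_center x hv
      rw [hx, (hcol e v).1, (hcol e v).2, portWeight_down_add_up (hst e) _ hv, add_right_comm,
        eq_comm, CharTwo.add_eq_zero] at h1
      exact h1.symm
    · rw [add_zero, innerWeight_of_not_incident x hv, innerWeight_of_not_incident x hv,
        adjWeight_comm]
  obtain ⟨k, hk⟩ := e
  induction k with
  | zero =>
    refine (fun h => ⟨h, right_of_left _ h⟩) ?_
    rw [← sum_left_of_eq_zero x (e := ⟨0, hk⟩) v rfl, hx, portWeight_left_of_eq_zero _ _ rfl]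
  | succ k ih =>
    refine (fun h => ⟨h, right_of_left _ h⟩) ?_
    have h1 := sum_left x (e := ⟨k + 1, hk⟩) (e' := ⟨k, by omega⟩) v rfl
    have h2 := sum_right x (e := ⟨k, by omega⟩) (e' := ⟨k + 1, hk⟩) v rfl
    rw [hx, eq_comm, CharTwo.add_eq_zero] at h1 h2
    rw [h1, adjWeight_comm, ← h2, (ih _).2]
    exact portWeight_right_eq_left _ v rfl

/-- A member of the cycle space of the grid graph gives an even edge set of the multigraph. -/
theorem isEven_comp_repEdge (hst : ∀ e, s e < t e) (hx : x ∈ (gridGraph s t).cycleSpace) :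
    IsEven s t (x ∘ repEdge s t) := by
  intro v
  rcases Nat.eq_zero_or_pos m with rfl | hm
  · simp
  -- Nothing leaves the row beyond the last column, so the prefix sum there, which is the whole sum
  -- at `v`, vanishes.
  · let e : Fin m := ⟨m - 1, by omega⟩
    have he : e.val + 1 = m := by simp only [e]; omega
    have h : ∀ e' : Fin m, e' ≤ e := fun e' => by rw [Fin.le_def]; omega
    have h1 := (innerWeight_left_and_right hst hx e v).2
    rw [← sum_right_of_last x v he, (mem_cycleSpace_iff_adjWeight x).1 hx] at h1
    simpa [portWeight, h] using h1.symm

/-- A member of the cycle space of the grid graph is determined by its representative edges. -/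
theorem eq_zero_of_comp_repEdge (hst : ∀ e, s e < t e) (hx : x ∈ (gridGraph s t).cycleSpace)
    (h0 : x ∘ repEdge s t = 0) : x = 0 := by
  have hcol := fun e v => innerWeight_down_and_up hst hx e v
  have hrow := fun e v => innerWeight_left_and_right hst hx e v
  simp only [h0, portWeight_zero] at hcol hrow
  rw [mem_cycleSpace_iff_adjWeight] at hx
  have key : ∀ a b, GridLink s t a b → (gridGraph s t).adjWeight x a b = 0 := by
    intro a b h
    cases h with
    | @rowOut e e' v h =>
      have := sum_right x v h
      rwa [hx, (hrow _ _).2, zero_add, eq_comm] at this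
    | @colOut e v v' h =>
      have := sum_up x e h
      rwa [hx, (hcol _ _).2, zero_add, eq_comm] at this
    | rowCross h1 h2 =>
      rw [← innerWeight_of_not_incident x (by tauto), (hrow _ _).1]
    | colCross h1 h2 =>
      rw [← innerWeight_of_not_incident x (by tauto), (hcol _ _).1]
    | left h =>
      rw [← innerWeight_of_incident x h (q := .right) (by simp) (by simp), (hrow _ _).1]
    | right h =>
      rw [adjWeight_comm, ← innerWeight_of_incident x h (q := .left) (by simp) (by simp),
        (hrow _ _).2]
    | up h =>
      rw [adjWeight_comm, ← innerWeight_of_incident x (.inl h) (q := .down) (by simp) (by simp),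
        (hcol _ _).2]
    | down h =>
      rw [← innerWeight_of_incident x (.inr h) (q := .up) (by simp) (by simp), (hcol _ _).1]
  funext ⟨e, he⟩
  induction e using Sym2.ind with
  | _ a b =>
    have hab : (gridGraph s t).Adj a b := he
    rw [← adjWeight_of_adj x hab]
    rcases hab with h | h
    · exact key _ _ h
    · rw [adjWeight_comm]
      exact key _ _ h

end Member

section Lift

variable (s t) in
/-- The weight of the edge between two adjacent nodes with given port weights. -/
def linkWeight (y : Fin m → ZMod 2) (a b : GridNode m n) : ZMod 2 :=
  if a.2.2 = .center then portWeight s t y b else portWeight s t y a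

/-- Both ends of a link prescribe the same weight, which makes `gridLift` well defined on unordered
pairs. -/
theorem GridLink.linkWeight_comm {y : Fin m → ZMod 2} {a b : GridNode m n}
    (h : GridLink s t a b) : linkWeight s t y a b = linkWeight s t y b a := by
  cases h with
  | rowOut h => simpa [linkWeight] using portWeight_right_eq_left y _ h
  | colOut h => simpa [linkWeight] using portWeight_up_eq_down y _ h
  | @rowCross e v h1 h2 =>
    simpa [linkWeight, h1, h2] using (portWeight_right (s := s) (t := t) y e v).symm
  | colCross h1 h2 =>
    simpa [linkWeight] using portWeight_down_eq_up_of_not_incident y (by tauto)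
  | left h => simp [linkWeight]
  | right h => simp [linkWeight]
  | up h => simp [linkWeight]
  | down h => simp [linkWeight]

open Classical in
variable (s t) in
/-- The edge weights of the grid graph that belong to an edge set of the multigraph. -/
noncomputable def gridLift (y : Fin m → ZMod 2) (e : (gridGraph s t).edgeSet) : ZMod 2 :=
  Sym2.lift ⟨fun a b => if (gridGraph s t).Adj a b then linkWeight s t y a b else 0, by
    intro a b
    simp only [adj_comm _ a b]
    refine ite_congr rfl (fun h => ?_) fun _ => rfl
    rcases h with h | h
    · exact h.linkWeight_comm.symm
    · exact h.linkWeight_comm⟩ e.val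

theorem adjWeight_gridLift (y : Fin m → ZMod 2) {a b : GridNode m n}
    (h : (gridGraph s t).Adj a b) :
    (gridGraph s t).adjWeight (gridLift s t y) a b = linkWeight s t y a b := by
  rw [adjWeight_of_adj _ h]
  simp [gridLift, h]

theorem innerWeight_gridLift {e : Fin m} (hst : s e < t e) (y : Fin m → ZMod 2) (v : Fin n) :
    (innerWeight (gridLift s t y) e v .left .right = portWeight s t y (e, v, .left) ∧
      innerWeight (gridLift s t y) e v .right .left = portWeight s t y (e, v, .right)) ∧
    innerWeight (gridLift s t y) e v .down .up = portWeight s t y (e, v, .down) ∧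
      innerWeight (gridLift s t y) e v .up .down = portWeight s t y (e, v, .up) := by
  by_cases hv : v = s e ∨ v = t e
  · refine ⟨⟨?_, ?_⟩, ?_, ?_⟩
    · rw [innerWeight_of_incident _ hv (by simp) (by simp), adjWeight_gridLift y (.inl (.left hv))]
      simp [linkWeight]
    · rw [innerWeight_of_incident _ hv (by simp) (by simp), adjWeight_gridLift y (.inr (.right hv))]
      simp [linkWeight]
    · rcases hv with rfl | rfl
      · rw [innerWeight_down_of_eq_s _ hst.ne]
        simp [portWeight]
      · rw [innerWeight_of_incident _ (.inr rfl) (by simp) (by simp),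
          adjWeight_gridLift y (.inl (.down rfl))]
        simp [linkWeight]
    · rcases hv with rfl | rfl
      · rw [innerWeight_of_incident _ (.inl rfl) (by simp) (by simp),
          adjWeight_gridLift y (.inr (.up rfl))]
        simp [linkWeight]
      · rw [innerWeight_up_of_eq_t _ hst.ne]
        simp [portWeight]
  · have hv' := not_or.1 hv
    simp only [innerWeight_of_not_incident _ hv]
    rw [adjWeight_gridLift y (.inl (.rowCross hv'.1 hv'.2)),
      adjWeight_gridLift y (.inr (.rowCross hv'.1 hv'.2)),
      adjWeight_gridLift y (.inl (.colCross hv'.1 hv'.2)),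
      adjWeight_gridLift y (.inr (.colCross hv'.1 hv'.2))]
    simp [linkWeight]

theorem gridLift_comp_repEdge (hst : ∀ e, s e < t e) (y : Fin m → ZMod 2) :
    gridLift s t y ∘ repEdge s t = y := by
  funext e
  have h : (gridGraph s t).Adj (e, s e, .center) (e, s e, .up) := .inl (.up rfl)
  have := adjWeight_gridLift y h
  rw [adjWeight_of_adj _ h] at this
  exact this.trans (by simp [linkWeight, portWeight, hst e])

/-- An even edge set of the multigraph gives a member of the cycle space of the grid graph. -/
theorem gridLift_mem_cycleSpace (hst : ∀ e, s e < t e) {y : Fin m → ZMod 2}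
    (hy : IsEven s t y) : gridLift s t y ∈ (gridGraph s t).cycleSpace := by
  rw [mem_cycleSpace_iff_adjWeight]
  -- At a port the inner and the outer edge both have the weight of the port and cancel modulo 2;
  -- only the border and the centers need separate arguments.
  have outer : ∀ a b, (gridGraph s t).Adj a b → a.2.2 ≠ .center →
      portWeight s t y a + (gridGraph s t).adjWeight (gridLift s t y) a b = 0 := by
    intro a b h ha
    rw [adjWeight_gridLift y h, linkWeight, if_neg ha, CharTwo.add_self_eq_zero]
  rintro ⟨e, v, p⟩
  have hin := innerWeight_gridLift (hst e) y v
  cases p with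
  | left =>
    rcases Nat.eq_zero_or_pos e.val with he | he
    · rw [sum_left_of_eq_zero _ v he, hin.1.1, portWeight_left_of_eq_zero y v he]
    · have he' : e.val = (⟨e.val - 1, by omega⟩ : Fin m).val + 1 := by simp only; omega
      rw [sum_left _ v he', hin.1.1]
      exact outer _ _ (.inr (.rowOut he')) (by simp)
  | right =>
    rcases Nat.lt_or_ge (e.val + 1) m with he | he
    · rw [sum_right _ (e' := ⟨e.val + 1, he⟩) v rfl, hin.1.2]
      exact outer _ _ (.inl (.rowOut rfl)) (by simp)
    · rw [sum_right_of_last _ v (by omega), hin.1.2, portWeight_right_of_last hy v (by omega)]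
  | down =>
    rcases Nat.eq_zero_or_pos v.val with hv | hv
    · rw [sum_down_of_eq_zero _ e hv, hin.2.1]
      simp [portWeight, Fin.lt_def, hv]
    · have hv' : v.val = (⟨v.val - 1, by omega⟩ : Fin n).val + 1 := by simp only; omega
      rw [sum_down _ e hv', hin.2.1]
      exact outer _ _ (.inr (.colOut hv')) (by simp)
  | up =>
    rcases Nat.lt_or_ge (v.val + 1) n with hv | hv
    · rw [sum_up _ e (v' := ⟨v.val + 1, hv⟩) rfl, hin.2.2]
      exact outer _ _ (.inl (.colOut rfl)) (by simp)
    · rw [sum_up_of_last _ e (by omega), hin.2.2]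
      refine if_neg fun h => ?_
      have := Fin.lt_def.1 h.2
      omega
  | center =>
    by_cases hv : v = s e ∨ v = t e
    · rw [sum_center _ hv, hin.1.1, hin.1.2, hin.2.1, hin.2.2,
        portWeight_down_add_up (hst e) y hv, portWeight_right, if_pos hv, ← add_assoc,
        CharTwo.add_self_eq_zero, zero_add, CharTwo.add_self_eq_zero]
    · exact sum_center_of_not_incident _ hv

end Lift

/-- The dimension of the cycle space of the grid graph. -/
theorem le_finrank_cycleSpace_gridGraph (hst : ∀ e, s e < t e) :
    m ≤ Module.finrank (ZMod 2) (gridGraph s t).cycleSpace + n := by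
  let inc : (Fin m → ZMod 2) →ₗ[ZMod 2] (Fin n → ZMod 2) :=
    LinearMap.pi fun v => ∑ e with v = s e ∨ v = t e, LinearMap.proj e
  have h1 := inc.finrank_range_add_finrank_ker
  have h2 := LinearMap.finrank_le_finrank_of_injective
    (f := (LinearMap.range inc).subtype) Subtype.val_injective
  let rep := LinearMap.funLeft (ZMod 2) (ZMod 2) (repEdge s t)
  -- The kernel of the incidence map consists of the even sets and has dimension at least `m - n`;
  -- lifting shows that restriction to the representative edges reaches all of it.
  have h3 : LinearMap.ker inc ≤ (gridGraph s t).cycleSpace.map rep := by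
    intro y hy
    refine ⟨gridLift s t y, gridLift_mem_cycleSpace hst fun v => ?_, gridLift_comp_repEdge hst y⟩
    simpa [inc] using congrFun (LinearMap.mem_ker.1 hy) v
  have h4 := (Submodule.finrank_mono h3).trans (Submodule.finrank_map_le rep _)
  simp only [Module.finrank_fin_fun] at h1 h2
  omega

/-- If every nonempty even edge set of the multigraph has at least `r` edges, the basis number of
the grid graph satisfies a lower bound. -/
theorem mul_le_basisNumber_gridGraph_mul (hst : ∀ e, s e < t e) {r : ℕ}
    (hr : ∀ y, IsEven s t y → y ≠ 0 → r ≤ {e | y e ≠ 0}.ncard) :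
    (m - n) * r ≤ (gridGraph s t).basisNumber * m := by
  classical
  obtain ⟨B, hspan, hli, hk⟩ := (gridGraph s t).exists_isCycleBasis_basisNumber
  set k := (gridGraph s t).basisNumber
  have hfin : B.Finite := B.toFinite
  lift B to Finset ((gridGraph s t).edgeSet → ZMod 2) using hfin
  have hcard : Module.finrank (ZMod 2) (gridGraph s t).cycleSpace = B.card := by
    rw [← hspan]
    exact finrank_span_finset_eq_card hli
  have hB : m - n ≤ B.card := by
    have := le_finrank_cycleSpace_gridGraph hst
    omega
  have h0 : (0 : (gridGraph s t).edgeSet → ZMod 2) ∉ B := fun h => hli.ne_zero h rfl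
  have hmem : ∀ x ∈ B, r ≤ (Finset.univ.filter fun e => x (repEdge s t e) ≠ 0).card := by
    intro x hx
    have hx' : x ∈ (gridGraph s t).cycleSpace := hspan ▸ Submodule.subset_span hx
    have := hr _ (isEven_comp_repEdge hst hx') fun h =>
      h0 (eq_zero_of_comp_repEdge hst hx' h ▸ hx)
    rw [← Set.ncard_coe_finset]
    simpa using this
  have hedge : ∀ e, (B.filter fun x => x (repEdge s t e) ≠ 0).card ≤ k := by
    intro e
    have := hk (repEdge s t e)
    rw [show {x | x ∈ (B : Set ((gridGraph s t).edgeSet → ZMod 2)) ∧ x (repEdge s t e) ≠ 0} =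
      ((B.filter fun x => x (repEdge s t e) ≠ 0 : Finset _) : Set _) by ext; simp,
      Set.encard_coe_eq_coe_finsetCard] at this
    exact_mod_cast this
  -- Double counting of the pairs of a basis member and a representative edge contained in it.
  calc (m - n) * r ≤ B.card * r := Nat.mul_le_mul_right r hB
    _ ≤ ∑ x ∈ B, (Finset.univ.filter fun e => x (repEdge s t e) ≠ 0).card := by
        simpa using Finset.card_nsmul_le_sum B _ r hmem
    _ = ∑ e, (B.filter fun x => x (repEdge s t e) ≠ 0).card :=
        Finset.sum_card_bipartiteAbove_eq_sum_card_bipartiteBelow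
          (fun (x : (gridGraph s t).edgeSet → ZMod 2) e => x (repEdge s t e) ≠ 0)
    _ ≤ k * m := by
        have := Finset.sum_le_card_nsmul Finset.univ _ k fun e _ => hedge e
        simpa [mul_comm] using this

end GridGraph

end SimpleGraph

/-! ### Multigraphs without short cycles from reduced words -/

section ReducedWords

/-- Words of length at most `r` over a three-letter alphabet without equal consecutive letters. -/
abbrev ReducedWord (r : ℕ) : Type :=
  {w : List (Fin 3) // w.IsChain (· ≠ ·) ∧ w.length ≤ r}

instance (r : ℕ) : Finite (ReducedWord r) :=
  Set.Finite.subset (List.finite_length_le (Fin 3) r) fun _ h => h.2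

namespace ReducedWord

variable {r : ℕ}

/-- Multiply a reduced word from the left by a letter, if the result is not too long. -/
def toggle (i : Fin 3) (w : ReducedWord r) : ReducedWord r :=
  if h : w.val.head? = some i then
    ⟨w.val.tail, w.2.1.tail, by have := w.2.2; simp; omega⟩
  else if hr : w.val.length < r then
    ⟨i :: w.val, by
      refine List.isChain_cons.2 ⟨fun y hy hyi => h ?_, w.2.1⟩
      rw [hyi]; exact hy, by simpa using hr⟩
  else w

theorem toggle_of_head?_ne {i : Fin 3} {w : ReducedWord r} (h : w.val.head? ≠ some i)
    (hr : w.val.length < r) : (toggle i w).val = i :: w.val := by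
  simp [toggle, h, hr]

/-- Insertion and deletion of a first letter undo each other, since a reduced word does not repeat
the deleted letter; words of full length that do not begin with `i` stay fixed. -/
theorem toggle_involutive (i : Fin 3) : Function.Involutive (toggle (r := r) i) := by
  rintro ⟨w, hw, hl⟩
  cases w with
  | nil =>
    by_cases hr : 0 < r <;> simp [toggle, hr]
  | cons j w =>
    rw [List.isChain_cons] at hw
    by_cases hj : j = i
    · subst hj
      have h1 : w.head? ≠ some j := fun h => hw.1 j h rfl
      have h2 : w.length < r := by simpa using hl
      simp [toggle, h1, h2]
    · by_cases hr : w.length + 1 < r <;> simp [toggle, hj, hr]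

/-- The permutation of the reduced words that is given by a letter. -/
def letter (i : Fin 3) : Equiv.Perm (ReducedWord r) := (toggle_involutive i).toPerm

theorem letter_mul_self (i : Fin 3) : letter (r := r) i * letter i = 1 :=
  Equiv.ext (toggle_involutive i)

/-- Following a reduced sequence of at most `r` letters produces a nontrivial permutation. -/
theorem walk_ne {τ : ℕ → Equiv.Perm (ReducedWord r)} {i : ℕ → Fin 3}
    (hτ : ∀ k, τ (k + 1) = τ k * letter (i k)) (hi : ∀ k, i (k + 1) ≠ i k) {j k : ℕ}
    (hjk : j < k) (hk : k ≤ j + r) : τ j ≠ τ k := by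
  let root : ReducedWord r := ⟨[], by simp, by simp⟩
  -- The quotient is the product of the letters `i j`, ..., `i (j + k - 1)`. Applied to the empty
  -- word it spells them out without cancellation; the induction splits off the leftmost letter.
  have key : ∀ k j, k ≤ r →
      (((τ j)⁻¹ * τ (j + k)) root).val.length = k ∧
      (0 < k → (((τ j)⁻¹ * τ (j + k)) root).val.head? = some (i j)) := by
    intro k
    induction k with
    | zero => intro j _; simp [root]
    | succ k ih =>
      intro j hk
      obtain ⟨h1, h2⟩ := ih (j + 1) (by omega)
      have h3 : (τ j)⁻¹ * τ (j + (k + 1)) =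
          letter (i j) * ((τ (j + 1))⁻¹ * τ (j + 1 + k)) := by
        rw [show j + (k + 1) = j + 1 + k by omega, hτ j, mul_inv_rev]
        simp [mul_assoc]
      rw [h3, Equiv.Perm.mul_apply]
      set w := ((τ (j + 1))⁻¹ * τ (j + 1 + k)) root
      have h4 : w.val.head? ≠ some (i j) := by
        rcases Nat.eq_zero_or_pos k with rfl | hpos
        · rw [List.length_eq_zero_iff.1 h1]; simp
        · rw [h2 hpos]
          simpa using hi j
      have h5 := toggle_of_head?_ne h4 (by omega)
      change (toggle (i j) w).val.length = k + 1 ∧ (0 < k + 1 → (toggle (i j) w).val.head? = _)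
      rw [h5]
      simp [h1]
  intro h
  obtain ⟨d, rfl⟩ := Nat.exists_eq_add_of_lt hjk
  have := (key (d + 1) j (by omega)).1
  rw [show j + (d + 1) = j + d + 1 by omega, ← h] at this
  simp [root] at this

end ReducedWord

open ReducedWord in
/-- In the bipartite double cover of the Cayley graph of the letters, a nonempty edge set in which
all degrees are even has at least `r` edges. -/
theorem le_card_support_of_even {r : ℕ}
    (z : Equiv.Perm (ReducedWord r) × Fin 3 → ZMod 2)
    (h₁ : ∀ σ, ∑ i, z (σ, i) = 0) (h₂ : ∀ σ, ∑ i, z (σ * letter i, i) = 0) (hz : z ≠ 0) :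
    r ≤ {e | z e ≠ 0}.ncard := by
  let P := Equiv.Perm (ReducedWord r)
  -- A state is a side of the double cover, a vertex on it and the label of an edge there. Edges are
  -- named by their end on the `true` side.
  let edge : Bool × P × Fin 3 → P × Fin 3 :=
    fun q => (if q.1 then q.2.1 else q.2.1 * letter q.2.2, q.2.2)
  have hsum : ∀ b σ, ∑ i, z (edge (b, σ, i)) = 0 := by
    intro b σ
    cases b
    · simpa [edge] using h₂ σ
    · simpa [edge] using h₁ σ
  -- By parity, an edge of the set cannot be the only one at its other end, so the walk continues
  -- with a different label.
  have hstep : ∀ b σ i, z (edge (b, σ, i)) ≠ 0 →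
      ∃ j, j ≠ i ∧ z (edge (!b, σ * letter i, j)) ≠ 0 := by
    intro b σ i h
    by_contra! hj
    have h3 : edge (!b, σ * letter i, i) = edge (b, σ, i) := by
      cases b
      · simp [edge]
      · simpa [edge, mul_assoc] using letter_mul_self i
    have h4 := hsum (!b) (σ * letter i)
    rw [Fintype.sum_eq_single i fun j hji => hj j hji, h3] at h4
    exact h h4
  let S := {q : Bool × P × Fin 3 // z (edge q) ≠ 0}
  have hnext : ∀ q : S, ∃ q' : S, q'.1.1 = !q.1.1 ∧ q'.1.2.1 = q.1.2.1 * letter q.1.2.2 ∧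
      q'.1.2.2 ≠ q.1.2.2 := by
    rintro ⟨⟨b, σ, i⟩, hq⟩
    obtain ⟨j, hj, h⟩ := hstep b σ i hq
    exact ⟨⟨(!b, σ * letter i, j), h⟩, rfl, rfl, hj⟩
  choose next hn₁ hn₂ hn₃ using hnext
  obtain ⟨⟨σ, i⟩, hσ⟩ := Function.ne_iff.1 hz
  let walk : ℕ → S := fun k => next^[k] ⟨(true, σ, i), by simpa [edge] using hσ⟩
  have hw : ∀ k, walk (k + 1) = next (walk k) := fun k => Function.iterate_succ_apply' _ _ _
  have hne : ∀ j k, j < k → k ≤ j + r → (walk j).1.2.1 ≠ (walk k).1.2.1 := fun j k =>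
    walk_ne (τ := fun k => (walk k).1.2.1) (i := fun k => (walk k).1.2.2)
      (fun k => by simp only [hw, hn₂]) (fun k => by simp only [hw]; exact hn₃ _)
  -- A repeated edge makes two vertices of the walk coincide within `r` steps, except when two
  -- consecutive steps use the same edge; then their labels would agree.
  have hinj : ∀ j k, j < k → k < r → edge (walk j).1 ≠ edge (walk k).1 := by
    intro j k hjk hk h
    simp only [edge, Prod.mk.injEq] at h
    obtain ⟨h, hi⟩ := h
    have e1 := hn₂ (walk j)
    have e2 := hn₂ (walk k)
    rw [← hw] at e1 e2
    rw [← e1, ← e2] at h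
    split_ifs at h
    · exact hne _ _ hjk (by omega) h
    · exact hne j (k + 1) (by omega) (by omega) h
    · rcases Nat.lt_or_ge (j + 1) k with h1 | h1
      · exact hne _ _ h1 (by omega) h
      · obtain rfl : k = j + 1 := by omega
        rw [hw] at hi
        exact hn₃ _ hi.symm
    · exact hne (j + 1) (k + 1) (by omega) (by omega) h
  have hinj' : Function.Injective fun k : Fin r => edge (walk k).1 := by
    intro j k h
    rcases lt_trichotomy j k with h1 | h1 | h1
    · exact absurd h (hinj _ _ h1 k.2)
    · exact h1
    · exact absurd h.symm (hinj _ _ h1 j.2)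
  have := Set.ncard_le_ncard (s := Set.range fun k : Fin r => edge (walk k).1)
    (t := {e | z e ≠ 0}) (by rintro _ ⟨k, rfl⟩; exact (walk k).2)
  rwa [← Nat.card_coe_set_eq, Nat.card_range_of_injective hinj', Nat.card_eq_fintype_card, Fintype.card_fin] at this

end ReducedWords

/-! ### Choice of the multigraph and conclusion -/

open SimpleGraph ReducedWord in
/-- There are grid graphs of arbitrarily large basis number. -/
theorem exists_gridGraph_le_basisNumber (k : ℕ) :
    ∃ (m n : ℕ) (s t : Fin m → Fin n), 0 < m ∧ (∀ e, s e < t e) ∧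
      k ≤ (gridGraph s t).basisNumber := by
  classical
  -- The factor 3 compensates for the ratio of `m = 3 * q` to `m - n = q` in the counting bound.
  let P := Equiv.Perm (ReducedWord (3 * k))
  obtain ⟨q, ⟨φ⟩⟩ := Finite.exists_equiv_fin P
  have hq : 0 < q := Fin.pos (φ 1)
  let ψ : P × Fin 3 ≃ Fin (q * 3) := (φ.prodCongr (Equiv.refl _)).trans finProdFinEquiv
  -- One side of the double cover occupies the lower rows and the other the upper rows, so every
  -- edge points upwards.
  have hlt : ∀ i j : Fin q, Fin.castAdd q i < Fin.natAdd q j := fun i j => by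
    rw [Fin.lt_def, Fin.val_castAdd, Fin.val_natAdd]
    omega
  let s : Fin (q * 3) → Fin (q + q) := fun e => Fin.castAdd q (φ (ψ.symm e).1)
  let t : Fin (q * 3) → Fin (q + q) :=
    fun e => Fin.natAdd q (φ ((ψ.symm e).1 * letter (ψ.symm e).2))
  have hst : ∀ e, s e < t e := fun e => hlt _ _
  have hs : ∀ σ e, (Fin.castAdd q (φ σ) = s e ∨ Fin.castAdd q (φ σ) = t e) ↔
      (ψ.symm e).1 = σ := by
    intro σ e
    have : Fin.castAdd q (φ σ) ≠ t e := (hlt _ _).ne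
    rw [or_iff_left this]
    simp only [s, Fin.castAdd_inj, φ.injective.eq_iff]
    exact eq_comm
  have ht : ∀ σ e, (Fin.natAdd q (φ σ) = s e ∨ Fin.natAdd q (φ σ) = t e) ↔
      (ψ.symm e).1 = σ * letter (ψ.symm e).2 := by
    intro σ e
    have : Fin.natAdd q (φ σ) ≠ s e := (hlt _ _).ne'
    rw [or_iff_right this]
    simp only [t, Fin.natAdd_inj, φ.injective.eq_iff]
    constructor
    · intro h
      rw [h, mul_assoc, letter_mul_self, mul_one]
    · intro h
      rw [h, mul_assoc, letter_mul_self, mul_one]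
  have hr : ∀ y, IsEven s t y → y ≠ 0 → 3 * k ≤ {e | y e ≠ 0}.ncard := by
    intro y hy h0
    -- Each vertex lies on exactly one edge of each label `i`, the edge `(f i, i)`; this turns
    -- evenness into the label sums for either side.
    have h1 : ∀ (v : Fin (q + q)) (f : Fin 3 → P),
        (∀ e, (v = s e ∨ v = t e) ↔ (ψ.symm e).1 = f (ψ.symm e).2) →
        ∑ i, y (ψ (f i, i)) = 0 := by
      intro v f hv
      rw [← hy v]
      refine Finset.sum_bij (fun i _ => ψ (f i, i)) ?_ ?_ ?_ fun _ _ => rfl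
      · intro i _
        simp [hv]
      · intro i _ j _ h
        exact (Prod.mk.inj (ψ.injective h)).2
      · intro e he
        refine ⟨(ψ.symm e).2, Finset.mem_univ _, ?_⟩
        rw [← (hv e).1 (Finset.mem_filter.1 he).2]
        simp
    have h2 := le_card_support_of_even (r := 3 * k) (fun a => y (ψ a))
      (fun σ => h1 _ (fun _ => σ) (hs σ)) (fun σ => h1 _ (fun i => σ * letter i) (ht σ))
      fun h => h0 (funext fun e => by simpa using congrFun h (ψ.symm e))
    refine h2.trans ?_
    rw [← Set.ncard_image_of_injective _ ψ.injective]
    refine Set.ncard_le_ncard ?_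
    rintro _ ⟨a, ha, rfl⟩
    exact ha
  refine ⟨q * 3, q + q, s, t, by omega, hst, ?_⟩
  have h := mul_le_basisNumber_gridGraph_mul hst hr
  rw [show q * 3 - (q + q) = q by omega] at h
  refine Nat.le_of_mul_le_mul_left (c := q * 3) ?_ (by omega)
  linarith

theorem theorem4p1 (ℓ : ℤ) :
    ∃ (V : Type) (_ : Fintype V) (G : SimpleGraph V) (_ : DecidableRel G.Adj),
      ℓ ≤ (G.basisNumber : ℤ) ∧ G.maxDegree = 3 ∧ G.IsOnePlanar ∧ G.IsICPlanar := by
  classical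
  obtain ⟨m, n, s, t, hm, hst, hk⟩ := exists_gridGraph_le_basisNumber ℓ.toNat
  have hIC : (SimpleGraph.gridGraph s t).IsICPlanar := SimpleGraph.gridGraph_isICPlanar
  refine ⟨SimpleGraph.GridNode m n, inferInstance, SimpleGraph.gridGraph s t, Classical.decRel _, ?_,
    SimpleGraph.gridGraph_maxDegree (fun e => (hst e).ne) hm, ?_, hIC⟩
  · exact (Int.self_le_toNat ℓ).trans (by exact_mod_cast hk)
  · obtain ⟨D, hD, -⟩ := hIC
    exact ⟨D, hD⟩
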